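/- Let $E$ be a finite set and let $(J_t,\xi_t)_{t\ge 0}$ be a càdlàg Markov additive process with values in $E\times\mathbb{R}$: it is adapted to a filtration $(\mathcal F_t)_{t\ge0}$ and there are laws $\mathbb P_{\alpha,x}$ (with expectations $\mathbb E_{\alpha,x}$), depending measurably on $(\alpha,x)\in E\times\mathbb R$, under which the process starts at $(J_0,\xi_0)=(\alpha,x)$ and satisfies, for all $s,t\ge 0$ and all bounded continuous $f:E\times\mathbb R\to[0,\infty)$, $$\mathbb E_{\alpha,x}\left[f(J_{t+s},\xi_{t+s}-\xi_t)\mid\mathcal F_t\right]=\mathbb E_{J_t,0}\left[f(J_s,\xi_s)\right].$$ Assume that $J$ is irreducible, and let $\mathbb E$ denote expectation when $(J_0,\xi_0)$ has an arbitrary fixed initial distribution. Put $Y_t=e^{\xi_t}$, let $r\in\mathbb R$ be the interest rate and $T>0$ the maturity. For $\alpha\in E$ and strike $k>0$ let $$C_\alpha(k)=e^{-rT}\,\mathbb E_{\alpha,0}\left[(Y_T-k)^+\right],\qquad P_\alpha(k)=e^{-rT}\,\mathbb E_{\alpha,0}\left[(k-Y_T)^+\right]$$ be the prices of the European call and put when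 the process starts at $(\alpha,0)$. For $z\in\mathbb C$ the matrix exponent $F(z)\in\mathbb C^{E\times E}$ is the (unique, when it exists) matrix such that, for all $t\ge 0$ and $\alpha,\beta\in E$, $e^{z\xi_t}$ is $\mathbb P_{\alpha,0}$-integrable and $\mathbb E_{\alpha,0}\left[e^{z\xi_t};\,J_t=\beta\right]=\left(e^{tF(z)}\right)_{\alpha,\beta}$. 1. If $\mathbb E[Y_T^{1+s}]<\infty$ for some $s>0$, then for all $\alpha\in E$ and all $u\in\mathbb C$ with $\operatorname{Re}u\in(0,s)$ the matrix exponent $F(u+1)$ exists, the integral below converges absolutely, and $$\int_0^\infty k^{u-1}C_\alpha(k)\,dk=\frac{e^{-rT}}{u(u+1)}\sum_{\beta\in E}\left(e^{TF(u+1)}\right)_{\alpha,\beta}.$$ 2. If $\mathbb E[Y_T^{-s}]<\infty$ for some $s>0$, then for all $\alpha\in E$ and all $u\in\mathbb C$ with $\operatorname{Re}u\in(-s,-1)$ the matrix exponent $F(u+1)$ exists, the integral below converges absolutely, and $$\int_0^\infty k^{u-1}P_\alpha(k)\,dk=\frac{e^{-rT}}{u(u+1)}\sum_{\beta\in E}\left(e^{TF(u+1)}\right)_{\alpha,\beta}.$$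 -/

import Mathlib

open MeasureTheory ProbabilityTheory Filter Topology
open scoped NNReal BoundedContinuousFunction

noncomputable section

/-- A path indexed by `[0, ∞)` is càdlàg: right-continuous with left limits at every time
(at time `0` the left-limit condition is void). -/
def IsCadlagPath {S : Type*} [TopologicalSpace S] (p : ℝ≥0 → S) : Prop :=
  ∀ t : ℝ≥0, ContinuousWithinAt p (Set.Ici t) t ∧ ∃ l : S, Tendsto p (𝓝[<] t) (𝓝 l)

/-- A Markov additive process `(J, ξ)` with finite state space `E` for `J`, together with the
Markov family `P` of probability measures: `P (α, x)` is the law under which the process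
starts at `(J₀, ξ₀) = (α, x)`. -/
structure MarkovAdditiveProcess (E Ω : Type*) [Fintype E] [TopologicalSpace E]
    [DiscreteTopology E] [MeasurableSpace E] [MeasurableSingletonClass E]
    [mΩ : MeasurableSpace Ω] where
  /-- the modulating process (market state) -/
  J : ℝ≥0 → Ω → E
  /-- the additive component (log-price) -/
  ξ : ℝ≥0 → Ω → ℝ
  /-- the filtration -/
  ℱ : Filtration ℝ≥0 mΩ
  /-- the laws, indexed by the starting point -/
  P : Kernel (E × ℝ) Ω
  isMarkovKernel_P : IsMarkovKernel P
  measurable_J : ∀ t, Measurable[ℱ t] (J t)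
  measurable_ξ : ∀ t, Measurable[ℱ t] (ξ t)
  start : ∀ (α : E) (x : ℝ), ∀ᵐ ω ∂(P (α, x)), J 0 ω = α ∧ ξ 0 ω = x
  cadlag : ∀ (α : E) (x : ℝ), ∀ᵐ ω ∂(P (α, x)),
    IsCadlagPath (fun t => J t ω) ∧ IsCadlagPath (fun t => ξ t ω)
  /-- `E[f(J_{t+s}, ξ_{t+s} - ξ_t) | ℱ_t] = E_{J_t,0}[f(J_s, ξ_s)]` -/
  markov_additive : ∀ (α : E) (x : ℝ) (t s : ℝ≥0) (f : E × ℝ →ᵇ ℝ), (∀ z, 0 ≤ f z) →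
    (P (α, x))[fun ω => f (J (t + s) ω, ξ (t + s) ω - ξ t ω) | ℱ t]
      =ᵐ[P (α, x)] fun ω => ∫ ω', f (J s ω', ξ s ω') ∂(P (J t ω, 0))

namespace MarkovAdditiveProcess

variable {E Ω : Type*} [Fintype E] [TopologicalSpace E] [DiscreteTopology E]
  [MeasurableSpace E] [MeasurableSingletonClass E] [MeasurableSpace Ω]

/-- The price process `Y = exp ξ`. -/
def Y (M : MarkovAdditiveProcess E Ω) (t : ℝ≥0) (ω : Ω) : ℝ := Real.exp (M.ξ t ω)

/-- The law of the process when `(J₀, ξ₀)` has distribution `ν`. -/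
def lawFrom (M : MarkovAdditiveProcess E Ω) (ν : Measure (E × ℝ)) : Measure Ω := ν.bind M.P

/-- Irreducibility of the finite-state chain `J`. -/
def Irreducible (M : MarkovAdditiveProcess E Ω) : Prop :=
  ∀ α β : E, ∃ t : ℝ≥0, 0 < M.P (α, 0) {ω | M.J t ω = β}

/-- `A` is a matrix exponent of the process at `z ∈ ℂ`: for all `t ≥ 0` the expectation
`E[e^{z ξ_t}; J_t = β | J₀ = α]` exists (with `ξ₀ = 0`) and equals the `(α, β)` entry
of `e^{tA}`. -/
def IsMatrixExponent [DecidableEq E] (M : MarkovAdditiveProcess E Ω) (z : ℂ)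
    (A : Matrix E E ℂ) : Prop :=
  ∀ (t : ℝ≥0) (α β : E),
    Integrable (fun ω => Complex.exp (z * (M.ξ t ω : ℂ))) (M.P (α, 0)) ∧
    ∫ ω in {ω | M.J t ω = β}, Complex.exp (z * (M.ξ t ω : ℂ)) ∂(M.P (α, 0))
      = NormedSpace.exp (((t : ℝ) : ℂ) • A) α β

section Unique

attribute [local instance] Matrix.linftyOpNormedRing Matrix.linftyOpNormedAlgebra

/-- There is at most one matrix exponent at each `z`. -/
theorem IsMatrixExponent.unique [DecidableEq E] {M : MarkovAdditiveProcess E Ω} {z : ℂ}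
    {A B : Matrix E E ℂ} (hA : M.IsMatrixExponent z A) (hB : M.IsMatrixExponent z B) :
    A = B := by
  have key : ∀ C : Matrix E E ℂ, HasDerivWithinAt
      (fun t : ℝ => NormedSpace.exp (t • C)) C (Set.Ici 0) 0 := by
    intro C
    have h := (hasDerivAt_exp_smul_const (𝕂 := ℝ) C (0 : ℝ)).hasDerivWithinAt (s := Set.Ici 0)
    rw [zero_smul, NormedSpace.exp_zero, one_mul] at h
    exact h
  have heq : ∀ t ∈ Set.Ici (0 : ℝ),
      NormedSpace.exp (t • A) = NormedSpace.exp (t • B) := by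
    intro t ht
    ext α β
    have h1 := (hA ⟨t, ht⟩ α β).2
    have h2 := (hB ⟨t, ht⟩ α β).2
    rw [h1] at h2
    exact h2
  have hB' := (key B).congr heq (heq 0 Set.self_mem_Ici)
  exact (uniqueDiffWithinAt_Ici (0 : ℝ)).eq_deriv _ (key A) hB'

end Unique

open Classical in
/-- The matrix exponent `F(z)` (with the value `0` at those `z` where there is none). -/
def matrixExponent [DecidableEq E] (M : MarkovAdditiveProcess E Ω) (z : ℂ) : Matrix E E ℂ :=
  if h : ∃ A, M.IsMatrixExponent z A then h.choose else 0

/-- The price `C_H(α, y, τ) = e^{-rτ} E_{(α, log y)}[H(Y_τ)]` of the European option with payoff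
`H` and time to maturity `τ`, when the current market state is `α` and the current price is `y`,
at risk-free rate `r`. -/
def europeanPrice (M : MarkovAdditiveProcess E Ω) (r : ℝ) (H : ℝ → ℝ) (α : E) (y : ℝ)
    (τ : ℝ≥0) : ℝ :=
  Real.exp (-r * τ) * ∫ ω, H (M.Y τ ω) ∂(M.P (α, Real.log y))

/-- Price of the European call with strike `k`, maturity `T`, started from `(α, 1)`. -/
def callPrice (M : MarkovAdditiveProcess E Ω) (r : ℝ) (T : ℝ≥0) (α : E) (k : ℝ) : ℝ :=
  M.europeanPrice r (fun x => max (x - k) 0) α 1 T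

/-- Price of the European put with strike `k`, maturity `T`, started from `(α, 1)`. -/
def putPrice (M : MarkovAdditiveProcess E Ω) (r : ℝ) (T : ℝ≥0) (α : E) (k : ℝ) : ℝ :=
  M.europeanPrice r (fun x => max (k - x) 0) α 1 T

end MarkovAdditiveProcess

end

/-! For a fixed price `y`, the Mellin transform in the strike of the call payoff (`0 < Re u`) and of
the put payoff (`Re u < -1`) is the same function `y ^ (u + 1) / (u (u + 1))`. As soon as `Y_T ^ (Re
u + 1)` is integrable, Fubini moves the transform inside the expectation and leaves the moment of
`Y_T` of order `u + 1`. Splitting it over the values of `J_T` turns it into a row sum of `exp (T F(u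
+ 1))`.

The real work is the existence of `F(u + 1)`, given only one moment of order `θ` at time `T` under
one initial law. Disintegrating that law gives one good initial state, since the starting level only
contributes a factor `e^{θx}`. By Chapman–Kolmogorov the joint moments of order `θ` form a matrix
semigroup with entries in `[0, ∞]`. Irreducibility makes each state reachable before time `T`,
because transition probabilities are analytic in time. Hence the moment is finite from every state
at some positive time, and then at all times (`Irreducible.expMoment_ne_top`).

For `Re z` strictly between `0` and `θ`, the matrices of moments of order `z` then form a finite
complex semigroup. Right-continuity of the paths and a truncation give continuity at `0`, and a
norm-continuous semigroup in a Banach algebra is an exponential (`exists_eq_exp_of_semigroup`). -/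

/-! ### Norm-continuous semigroups in a Banach algebra. -/

/-- A one-parameter semigroup in a Banach algebra that is continuous at `0` is continuous. -/
theorem continuous_of_semigroup {A : Type*} [NormedRing A] [CompleteSpace A] {S : ℝ≥0 → A}
    (h0 : S 0 = 1) (hadd : ∀ s t, S (s + t) = S s * S t)
    (hc : ContinuousAt S 0) : Continuous S := by
  rw [continuous_iff_continuousAt]
  intro t
  have h1 : Tendsto (fun x : ℝ≥0 => S (x - t)) (𝓝 t) (𝓝 1) := by
    have : Tendsto (fun x : ℝ≥0 => x - t) (𝓝 t) (𝓝 0) := by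
      have : Continuous fun x : ℝ≥0 => x - t := by fun_prop
      simpa using this.tendsto t
    simpa [h0, Function.comp_def] using hc.tendsto.comp this
  have h2 : Tendsto (fun x : ℝ≥0 => S (t - x)) (𝓝 t) (𝓝 1) := by
    have : Tendsto (fun x : ℝ≥0 => t - x) (𝓝 t) (𝓝 0) := by
      have : Continuous fun x : ℝ≥0 => t - x := by fun_prop
      simpa using this.tendsto t
    simpa [h0, Function.comp_def] using hc.tendsto.comp this
  have hu : ∀ᶠ x in 𝓝 t, IsUnit (S (t - x)) :=
    h2.eventually (Units.isOpen.mem_nhds isUnit_one)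
  have hinv : Tendsto (fun x => Ring.inverse (S (t - x))) (𝓝 t) (𝓝 1) := by
    have := (NormedRing.inverse_continuousAt (1 : Aˣ)).tendsto
    simp only [Units.val_one, Ring.inverse_one] at this
    exact this.comp h2
  -- Subtraction on `ℝ≥0` is truncated, so `t + (x - t)` and `x + (t - x)` both equal `max t x`.
  -- This treats left and right continuity at once.
  have key : Tendsto (fun x => S t * S (x - t) * Ring.inverse (S (t - x))) (𝓝 t) (𝓝 (S t)) := by
    simpa using (h1.const_mul (S t)).mul hinv
  refine key.congr' ?_
  filter_upwards [hu] with x hx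
  have : S t * S (x - t) = S x * S (t - x) := by
    rw [← hadd, ← hadd]
    congr 1
    rw [add_tsub_eq_max, add_tsub_eq_max, max_comm]
  rw [this, mul_assoc, Ring.mul_inverse_cancel _ hx, mul_one]

/-- A one-parameter semigroup in a Banach algebra that is norm-continuous at `0` has the form
`t ↦ exp (t a)`. -/
theorem exists_eq_exp_of_semigroup {A : Type*} [NormedRing A] [NormedAlgebra ℝ A]
    [CompleteSpace A] {S : ℝ≥0 → A} (h0 : S 0 = 1) (hadd : ∀ s t, S (s + t) = S s * S t)
    (hc : ContinuousAt S 0) : ∃ a : A, ∀ t : ℝ≥0, S t = NormedSpace.exp ((t : ℝ) • a) := by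
  have hS := continuous_of_semigroup h0 hadd hc
  set f : ℝ → A := fun t => S t.toNNReal with hf
  have hfc : Continuous f := hS.comp continuous_real_toNNReal
  have hf0 : f 0 = 1 := by simp [hf, h0]
  have hfadd : ∀ s t : ℝ, 0 ≤ s → 0 ≤ t → f (s + t) = f s * f t := fun s t hs ht => by
    simp only [hf, Real.toNNReal_add hs ht, hadd]
  set F : ℝ → A := fun t => ∫ x in (0 : ℝ)..t, f x with hF
  have hFd : ∀ t, HasDerivAt F (f t) t := fun t =>
    intervalIntegral.integral_hasDerivAt_right (hfc.intervalIntegrable _ _)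
      (hfc.stronglyMeasurableAtFilter _ _) hfc.continuousAt
  -- The averages `F δ / δ` tend to `f 0 = 1`, and the units are open.
  obtain ⟨δ, hδ, hunit⟩ : ∃ δ : ℝ, 0 < δ ∧ IsUnit (F δ) := by
    have h := hasDerivAt_iff_tendsto_slope.1 (hFd 0)
    rw [hf0] at h
    have h2 := (h.mono_left (nhdsGT_le_nhdsNE (0 : ℝ))).eventually
      (Units.isOpen.mem_nhds isUnit_one)
    obtain ⟨δ, hδu, hδ⟩ := (h2.and self_mem_nhdsWithin).exists
    refine ⟨δ, hδ, ?_⟩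
    have hne : δ ≠ 0 := ne_of_gt hδ
    have : F δ = algebraMap ℝ A δ * slope F 0 δ := by
      rw [← Algebra.smul_def, slope_def_module]
      simp [hF, smul_smul, hne]
    rw [this]
    exact ((IsUnit.mk0 δ hne).map (algebraMap ℝ A)).mul hδu
  set W := Ring.inverse (F δ)
  have hVW : F δ * W = 1 := Ring.mul_inverse_cancel _ hunit
  have hshift : ∀ t : ℝ, 0 ≤ t → F (t + δ) - F t = f t * F δ := by
    intro t ht
    simp only [hF]
    rw [intervalIntegral.integral_interval_sub_left (hfc.intervalIntegrable _ _)
      (hfc.intervalIntegrable _ _)]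
    have hmul : f t * ∫ x in (0:ℝ)..δ, f x = ∫ x in (0:ℝ)..δ, f t * f x :=
      ((ContinuousLinearMap.mul ℝ A (f t)).intervalIntegral_comp_comm
        (hfc.intervalIntegrable _ _)).symm
    rw [hmul]
    have : ∫ x in (0:ℝ)..δ, f t * f x = ∫ x in (0:ℝ)..δ, f (t + x) := by
      refine intervalIntegral.integral_congr fun x hx => ?_
      rw [Set.uIcc_of_le hδ.le] at hx
      exact (hfadd t x ht hx.1).symm
    rw [this, intervalIntegral.integral_comp_add_left, add_zero]
  -- Since `f t = (F (t + δ) - F t) * W`, the function `f` inherits differentiability from its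
  -- primitive; its derivative is `(f (t + δ) - f t) * W = f t * a`.
  set a : A := (f δ - 1) * W with ha
  refine ⟨a, ?_⟩
  set G : ℝ → A := fun t => (F (t + δ) - F t) * W with hG
  have hGf : ∀ t, 0 ≤ t → G t = f t := fun t ht => by
    simp only [hG]; rw [hshift t ht, mul_assoc, hVW, mul_one]
  have hGd : ∀ t, 0 ≤ t → HasDerivAt G (G t * a) t := by
    intro t ht
    have h := (((hFd (t + δ)).comp_add_const t δ).sub (hFd t)).mul_const W
    refine h.congr_deriv ?_
    rw [hGf t ht, hfadd t δ ht hδ.le, ha]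
    noncomm_ring
  set H : ℝ → A := fun t => G t * NormedSpace.exp (t • (-a)) with hH
  have hHd : ∀ t, 0 ≤ t → HasDerivAt H 0 t := by
    intro t ht
    have h := (hGd t ht).mul (hasDerivAt_exp_smul_const' (𝕂 := ℝ) (-a) t)
    refine h.congr_deriv ?_
    noncomm_ring
  intro t
  have hconst : H t = H 0 :=
    constant_of_has_deriv_right_zero (a := 0) (b := (t : ℝ))
      (fun x hx => (hHd x hx.1).continuousAt.continuousWithinAt)
      (fun x hx => (hHd x hx.1).hasDerivWithinAt) t ⟨t.2, le_rfl⟩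
  have hH0 : H 0 = 1 := by simp [hH, hGf 0 le_rfl, hf0]
  have hfin : S t * NormedSpace.exp ((t : ℝ) • (-a)) = 1 := by
    rw [← hH0, ← hconst, hH]
    simp only
    rw [hGf t t.2]
    simp [hf]
  let _ : NormedAlgebra ℚ A := .restrictScalars ℚ ℝ A
  have hexp : NormedSpace.exp ((t : ℝ) • (-a)) * NormedSpace.exp ((t : ℝ) • a) = 1 := by
    rw [← NormedSpace.exp_add_of_commute]
    · simp
    · simp
  calc S t = S t * (NormedSpace.exp ((t : ℝ) • (-a)) * NormedSpace.exp ((t : ℝ) • a)) := by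
        rw [hexp, mul_one]
    _ = _ := by rw [← mul_assoc, hfin, one_mul]

/-! ### Transition laws and their convolution semigroup. -/

namespace MarkovAdditiveProcess

open scoped ENNReal

variable {E Ω : Type*} [Fintype E] [TopologicalSpace E] [DiscreteTopology E]
  [MeasurableSpace E] [MeasurableSingletonClass E] [MeasurableSpace Ω]
  (M : MarkovAdditiveProcess E Ω)

instance : IsMarkovKernel M.P := M.isMarkovKernel_P

theorem measurable_J' (t : ℝ≥0) : Measurable (M.J t) := (M.measurable_J t).mono (M.ℱ.le t) le_rfl

theorem measurable_ξ' (t : ℝ≥0) : Measurable (M.ξ t) := (M.measurable_ξ t).mono (M.ℱ.le t) le_rfl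

theorem measurableSet_J (t : ℝ≥0) (β : E) : MeasurableSet {ω | M.J t ω = β} :=
  M.measurable_J' t (measurableSet_singleton β)

/-- On an event of `ℱ t` on which `J t = β`, the future increment has the law of the process
started at `(β, 0)` and is independent of the past. -/
theorem map_increment_restrict (α : E) (x : ℝ) (t s : ℝ≥0) (β : E) {B : Set Ω}
    (hB : MeasurableSet[M.ℱ t] B) (hBβ : ∀ ω ∈ B, M.J t ω = β) :
    ((M.P (α, x)).restrict B).map (fun ω => (M.J (t + s) ω, M.ξ (t + s) ω - M.ξ t ω))
      = (M.P (α, x) B) • (M.P (β, 0)).map (fun ω => (M.J s ω, M.ξ s ω)) := by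
  have hm1 : Measurable (fun ω => (M.J (t + s) ω, M.ξ (t + s) ω - M.ξ t ω)) :=
    (M.measurable_J' _).prodMk ((M.measurable_ξ' _).sub (M.measurable_ξ' _))
  have hm2 : Measurable (fun ω => (M.J s ω, M.ξ s ω)) :=
    (M.measurable_J' _).prodMk (M.measurable_ξ' _)
  have hB' : MeasurableSet B := M.ℱ.le t B hB
  have : IsFiniteMeasure ((M.P (α, x) B) • (M.P (β, 0)).map (fun ω => (M.J s ω, M.ξ s ω))) :=
    Measure.smul_finite _ (measure_ne_top _ _)
  refine ext_of_forall_lintegral_eq_of_IsFiniteMeasure fun f => ?_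
  rw [← ENNReal.toReal_eq_toReal_iff' (f.lintegral_lt_top_of_nnreal _).ne
    (f.lintegral_lt_top_of_nnreal _).ne, f.toReal_lintegral_coe_eq_integral,
    f.toReal_lintegral_coe_eq_integral]
  have hfm : Measurable fun z => (f z : ℝ) := (NNReal.continuous_coe.comp f.continuous).measurable
  let g : E × ℝ →ᵇ ℝ := BoundedContinuousFunction.ofNormedAddCommGroup (fun z => (f z : ℝ))
    (NNReal.continuous_coe.comp f.continuous) (nndist f 0) (fun z => by
      have h : (f z : ℝ) ≤ nndist f 0 := by
        exact_mod_cast BoundedContinuousFunction.NNReal.upper_bound f z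
      simpa using h)
  have hg := M.markov_additive α x t s g (fun z => (f z).2)
  have hint : Integrable (fun ω => g (M.J (t + s) ω, M.ξ (t + s) ω - M.ξ t ω)) (M.P (α, x)) :=
    (g.integrable _).comp_measurable hm1
  rw [integral_map hm1.aemeasurable hfm.aestronglyMeasurable, integral_smul_measure,
    integral_map hm2.aemeasurable hfm.aestronglyMeasurable]
  calc ∫ ω in B, g (M.J (t + s) ω, M.ξ (t + s) ω - M.ξ t ω) ∂(M.P (α, x))
      = ∫ ω in B, ((M.P (α, x))[fun ω => g (M.J (t + s) ω, M.ξ (t + s) ω - M.ξ t ω) | M.ℱ t]) ω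
          ∂(M.P (α, x)) := (setIntegral_condExp (M.ℱ.le t) hint hB).symm
    _ = ∫ ω in B, (∫ ω', g (M.J s ω', M.ξ s ω') ∂(M.P (β, 0))) ∂(M.P (α, x)) := by
        refine setIntegral_congr_ae hB' ?_
        filter_upwards [hg] with ω hω hωB
        rw [hω, hBβ ω hωB]
    _ = _ := by simp [g, measureReal_def]

/-- The law of `ξ t` on the event `J t = β`, when the process starts at `(α, 0)`. -/
noncomputable def transLaw (t : ℝ≥0) (α β : E) : Measure ℝ :=
  ((M.P (α, 0)).restrict {ω | M.J t ω = β}).map (M.ξ t)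

instance (t : ℝ≥0) (α β : E) : IsFiniteMeasure (M.transLaw t α β) := by
  unfold transLaw; infer_instance

theorem lintegral_transLaw (t : ℝ≥0) (α β : E) {g : ℝ → ℝ≥0∞} (hg : Measurable g) :
    ∫⁻ y, g y ∂(M.transLaw t α β) = ∫⁻ ω in {ω | M.J t ω = β}, g (M.ξ t ω) ∂(M.P (α, 0)) :=
  lintegral_map hg (M.measurable_ξ' t)

theorem integral_transLaw (t : ℝ≥0) (α β : E) {g : ℝ → ℂ} (hg : Measurable g) :
    ∫ y, g y ∂(M.transLaw t α β) = ∫ ω in {ω | M.J t ω = β}, g (M.ξ t ω) ∂(M.P (α, 0)) :=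
  integral_map (M.measurable_ξ' t).aemeasurable hg.aestronglyMeasurable

theorem sum_restrict_J (μ : Measure Ω) (t : ℝ≥0) :
    ∑ β, μ.restrict {ω | M.J t ω = β} = μ := by
  ext s hs
  simp only [Measure.finsetSum_apply, Measure.restrict_apply hs]
  rw [← measure_biUnion_finset]
  · congr 1
    ext ω
    simp
  · intro a _ b _ hab
    refine Set.disjoint_left.2 fun ω h1 h2 => hab ?_
    rw [← h1.2, ← h2.2]
  · exact fun β _ => hs.inter (M.measurableSet_J t β)

theorem sum_lintegral_transLaw (t : ℝ≥0) (α : E) {g : ℝ → ℝ≥0∞} (hg : Measurable g) :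
    ∑ β, ∫⁻ y, g y ∂(M.transLaw t α β) = ∫⁻ ω, g (M.ξ t ω) ∂(M.P (α, 0)) := by
  simp only [M.lintegral_transLaw t α _ hg]
  rw [← lintegral_finsetSum_measure, M.sum_restrict_J]

/-- The Chapman–Kolmogorov equations. -/
theorem transLaw_add (t s : ℝ≥0) (α γ : E) :
    M.transLaw (t + s) α γ = ∑ β, (M.transLaw t α β) ∗ (M.transLaw s β γ) := by
  have hm1 : Measurable (fun ω => (M.J (t + s) ω, M.ξ (t + s) ω - M.ξ t ω)) :=
    (M.measurable_J' _).prodMk ((M.measurable_ξ' _).sub (M.measurable_ξ' _))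
  have hm2 : Measurable (fun ω => (M.J s ω, M.ξ s ω)) :=
    (M.measurable_J' _).prodMk (M.measurable_ξ' _)
  have hmp : Measurable (fun ω => (M.ξ t ω, M.ξ (t + s) ω - M.ξ t ω)) :=
    (M.measurable_ξ' _).prodMk ((M.measurable_ξ' _).sub (M.measurable_ξ' _))
  -- Given `J t = β`, the past level and the future increment are independent, so their joint law on
  -- `J (t + s) = γ` is a product; adding the coordinates gives the convolution.
  have key : ∀ β, (((M.P (α, 0)).restrict {ω | M.J (t + s) ω = γ}).restrict
      {ω | M.J t ω = β}).map (fun ω => (M.ξ t ω, M.ξ (t + s) ω - M.ξ t ω))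
      = (M.transLaw t α β).prod (M.transLaw s β γ) := by
    intro β
    refine (Measure.prod_eq fun A C hA hC => ?_).symm
    rw [Measure.map_apply hmp (hA.prod hC), Measure.restrict_apply (hmp (hA.prod hC))]
    have hA' : MeasurableSet[M.ℱ t] (M.ξ t ⁻¹' A ∩ {ω | M.J t ω = β}) :=
      MeasurableSet.inter (M.measurable_ξ t hA) (M.measurable_J t (measurableSet_singleton β))
    have h := congrArg (fun μ => μ ({γ} ×ˢ C))
      (M.map_increment_restrict α 0 t s β hA' (fun ω hω => hω.2))
    have hγC : MeasurableSet (({γ} : Set E) ×ˢ C) := (measurableSet_singleton γ).prod hC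
    simp only [Measure.smul_apply, smul_eq_mul] at h
    rw [Measure.map_apply hm1 hγC, Measure.map_apply hm2 hγC,
      Measure.restrict_apply (hm1 hγC)] at h
    rw [Measure.restrict_apply ((hmp (hA.prod hC)).inter (M.measurableSet_J t β)), transLaw, transLaw,
      Measure.map_apply (M.measurable_ξ' _) hA, Measure.map_apply (M.measurable_ξ' _) hC,
      Measure.restrict_apply (M.measurable_ξ' _ hA), Measure.restrict_apply (M.measurable_ξ' _ hC)]
    convert h using 2
    · ext ω
      simp only [Set.mem_inter_iff, Set.mem_preimage, Set.mem_prod, Set.mem_ofPred_eq,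
        Set.mem_singleton_iff]
      tauto
    · congr 1
      ext ω
      simp only [Set.mem_inter_iff, Set.mem_preimage, Set.mem_prod, Set.mem_ofPred_eq,
        Set.mem_singleton_iff]
      tauto
  have hadd : M.ξ (t + s) = (fun p : ℝ × ℝ => p.1 + p.2) ∘
      (fun ω => (M.ξ t ω, M.ξ (t + s) ω - M.ξ t ω)) := by
    ext ω; simp
  conv_lhs => rw [transLaw, ← M.sum_restrict_J ((M.P (α, 0)).restrict {ω | M.J (t + s) ω = γ}) t]
  rw [hadd, Measure.map_finset_sum (by rw [← hadd]; exact (M.measurable_ξ' _).aemeasurable)]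
  refine Finset.sum_congr rfl fun β _ => ?_
  rw [← Measure.map_map (by fun_prop) hmp, key]
  rfl

/-- The process started at `(α, x)` is, in law, the process started at `(α, 0)` shifted by `x`. -/
theorem map_ξ_start (α : E) (x : ℝ) (t : ℝ≥0) :
    (M.P (α, x)).map (M.ξ t) = ((M.P (α, 0)).map (M.ξ t)).map (fun y => x + y) := by
  -- The Markov additive property at time `0`, where `J` is almost surely `α` and `ξ` is almost
  -- surely `x`.
  have hB : MeasurableSet[M.ℱ 0] {ω | M.J 0 ω = α} := M.measurable_J 0 (measurableSet_singleton α)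
  have h := M.map_increment_restrict α x 0 t α hB (fun ω hω => hω)
  have h1 : (M.P (α, x)) {ω | M.J 0 ω = α} = 1 := by
    rw [prob_compl_eq_zero_iff (M.measurableSet_J 0 α) |>.symm]
    exact ae_iff.1 ((M.start α x).mono fun ω hω => hω.1)
  have h2 : (M.P (α, x)).restrict {ω | M.J 0 ω = α} = M.P (α, x) :=
    Measure.restrict_eq_self_of_ae_mem ((M.start α x).mono fun ω hω => hω.1)
  have hm1 : Measurable (fun ω => (M.J (0 + t) ω, M.ξ (0 + t) ω - M.ξ 0 ω)) :=
    (M.measurable_J' _).prodMk ((M.measurable_ξ' _).sub (M.measurable_ξ' _))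
  have hm2 : Measurable (fun ω => (M.J t ω, M.ξ t ω)) :=
    (M.measurable_J' _).prodMk (M.measurable_ξ' _)
  rw [h1, h2, one_smul] at h
  have h3 := congrArg (fun μ => μ.map (fun p : E × ℝ => x + p.2)) h
  rw [Measure.map_map (by fun_prop) hm1, Measure.map_map (by fun_prop) hm2] at h3
  rw [Measure.map_map (by fun_prop) (M.measurable_ξ' _)]
  refine Eq.trans (Measure.map_congr ?_) h3
  filter_upwards [M.start α x] with ω hω
  simp [hω.2]

theorem transLaw_zero [DecidableEq E] (α β : E) :
    M.transLaw 0 α β = if α = β then Measure.dirac 0 else 0 := by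
  have h2 : (M.P (α, 0)).map (M.ξ 0) = Measure.dirac 0 := by
    rw [Measure.map_congr (g := fun _ => 0) ((M.start α 0).mono fun ω hω => hω.2)]
    simp
  split_ifs with h
  · subst h
    have h3 : (M.P (α, 0)).restrict {ω | M.J 0 ω = α} = M.P (α, 0) :=
      Measure.restrict_eq_self_of_ae_mem ((M.start α 0).mono fun ω hω => hω.1)
    rw [transLaw, h3, h2]
  · rw [transLaw, Measure.restrict_eq_zero.2, Measure.map_zero]
    refine measure_mono_null ?_ (ae_iff.1 (M.start α 0))
    intro ω hω hω'
    exact h (hω'.1.symm.trans hω)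

/-- Vague right-continuity of the transition laws at time `0`. -/
theorem tendsto_integral_transLaw_zero [DecidableEq E] (α β : E) {g : ℝ → ℂ} (hg : Continuous g)
    {C : ℝ} (hC : ∀ y, ‖g y‖ ≤ C) :
    Tendsto (fun t : ℝ≥0 => ∫ y, g y ∂(M.transLaw t α β)) (𝓝 0)
      (𝓝 (if α = β then g 0 else 0)) := by
  have hC0 : 0 ≤ C := (norm_nonneg _).trans (hC 0)
  have h1 : ∀ t, ∫ y, g y ∂(M.transLaw t α β)
      = ∫ ω, {ω | M.J t ω = β}.indicator (fun ω => g (M.ξ t ω)) ω ∂(M.P (α, 0)) := fun t => by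
    rw [M.integral_transLaw t α β hg.measurable, integral_indicator (M.measurableSet_J t β)]
  have h2 : (if α = β then g 0 else 0) = ∫ _, (if α = β then g 0 else 0) ∂(M.P (α, 0)) := by simp
  simp only [h1]
  rw [h2]
  refine tendsto_integral_filter_of_dominated_convergence (fun _ => C) ?_ ?_
    (integrable_const _) ?_
  · exact .of_forall fun t => ((hg.measurable.comp (M.measurable_ξ' t)).indicator
      (M.measurableSet_J t β)).aestronglyMeasurable
  · refine .of_forall fun t => .of_forall fun ω => ?_
    exact (norm_indicator_le_norm_self _ _).trans (hC _)
  · filter_upwards [M.start α 0, M.cadlag α 0] with ω hs hc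
    have hI : (Set.Ici 0 : Set ℝ≥0) = Set.univ := by ext; simp
    have hJ := (hc.1 0).1
    have hξ := (hc.2 0).1
    rw [hI, continuousWithinAt_univ, ContinuousAt] at hJ hξ
    simp only [hs.1, hs.2] at hJ hξ
    have hJ' : ∀ᶠ t in 𝓝 0, M.J t ω = α := by
      rw [nhds_discrete E, tendsto_pure] at hJ
      exact hJ
    split_ifs with h
    · refine ((hg.tendsto 0).comp hξ).congr' ?_
      filter_upwards [hJ'] with t ht
      simp [h ▸ ht]
    · refine tendsto_const_nhds.congr' ?_
      filter_upwards [hJ'] with t ht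
      simp [ht, h]

end MarkovAdditiveProcess

/-! ### Exponentials under convolution, and domination at interior exponents. -/

theorem lintegral_exp_conv (θ : ℝ) (μ ν : Measure ℝ) [SFinite ν] :
    ∫⁻ y, ENNReal.ofReal (Real.exp (θ * y)) ∂(μ ∗ ν)
      = (∫⁻ y, ENNReal.ofReal (Real.exp (θ * y)) ∂μ)
        * ∫⁻ y, ENNReal.ofReal (Real.exp (θ * y)) ∂ν := by
  rw [Measure.lintegral_conv (by fun_prop), ← lintegral_mul_const _ (by fun_prop)]
  refine lintegral_congr fun x => ?_
  rw [← lintegral_const_mul _ (by fun_prop)]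
  refine lintegral_congr fun y => ?_
  rw [mul_add, Real.exp_add, ENNReal.ofReal_mul (Real.exp_nonneg _)]

theorem integrable_cexp_conv {z : ℂ} {μ ν : Measure ℝ} [SFinite μ] [SFinite ν]
    (hμ : Integrable (fun y : ℝ => Complex.exp (z * y)) μ)
    (hν : Integrable (fun y : ℝ => Complex.exp (z * y)) ν) :
    Integrable (fun y : ℝ => Complex.exp (z * y)) (μ ∗ ν) := by
  rw [Measure.conv, integrable_map_measure (by fun_prop) (by fun_prop)]
  refine (hμ.mul_prod hν).congr (.of_forall fun p => ?_)
  simp [mul_add, Complex.exp_add]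

theorem integral_cexp_conv (z : ℂ) (μ ν : Measure ℝ) [SFinite μ] [SFinite ν] :
    ∫ y : ℝ, Complex.exp (z * y) ∂(μ ∗ ν)
      = (∫ y : ℝ, Complex.exp (z * y) ∂μ) * ∫ y : ℝ, Complex.exp (z * y) ∂ν := by
  rw [Measure.conv, integral_map (by fun_prop) (by fun_prop), ← integral_prod_mul]
  simp [mul_add, Complex.exp_add]

theorem norm_cexp_mul_ofReal {z : ℂ} {c θ : ℝ} (hz : z.re = c * θ) (y : ℝ) :
    ‖Complex.exp (z * y)‖ = Real.exp (c * (θ * y)) := by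
  rw [Complex.norm_exp]; simp [hz, mul_assoc]

theorem norm_cexp_le {z : ℂ} {c θ : ℝ} (hz : z.re = c * θ) (h0 : 0 < c) (h1 : c < 1) (y : ℝ) :
    ‖Complex.exp (z * y)‖ ≤ 1 + Real.exp (θ * y) := by
  rw [norm_cexp_mul_ofReal hz]
  rcases le_total (θ * y) 0 with h | h
  · have : Real.exp (c * (θ * y)) ≤ 1 := Real.exp_le_one_iff.2 
      (mul_nonpos_of_nonneg_of_nonpos h0.le h)
    linarith [Real.exp_pos (θ * y)]
  · have : Real.exp (c * (θ * y)) ≤ Real.exp (θ * y) := Real.exp_le_exp.2 (by nlinarith)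
    linarith

/-! ### Exponential moments: finiteness, bounds and continuity at time zero. -/

namespace MarkovAdditiveProcess

open scoped ENNReal

variable {E Ω : Type*} [Fintype E] [TopologicalSpace E] [DiscreteTopology E]
  [MeasurableSpace E] [MeasurableSingletonClass E] [MeasurableSpace Ω]
  (M : MarkovAdditiveProcess E Ω)

/-- The real exponential moment of `ξ t` on `J t = β`, started at `(α, 0)`. -/
noncomputable def jointMoment (θ : ℝ) (t : ℝ≥0) (α β : E) : ℝ≥0∞ :=
  ∫⁻ y, ENNReal.ofReal (Real.exp (θ * y)) ∂(M.transLaw t α β)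

/-- The real exponential moment of `ξ t`, started at `(α, 0)`. -/
noncomputable def expMoment (θ : ℝ) (t : ℝ≥0) (α : E) : ℝ≥0∞ :=
  ∫⁻ ω, ENNReal.ofReal (Real.exp (θ * M.ξ t ω)) ∂(M.P (α, 0))

theorem sum_jointMoment (θ : ℝ) (t : ℝ≥0) (α : E) :
    ∑ β, M.jointMoment θ t α β = M.expMoment θ t α :=
  M.sum_lintegral_transLaw t α (g := fun y => ENNReal.ofReal (Real.exp (θ * y))) (by fun_prop)

theorem jointMoment_le (θ : ℝ) (t : ℝ≥0) (α β : E) :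
    M.jointMoment θ t α β ≤ M.expMoment θ t α := by
  rw [← M.sum_jointMoment]
  exact Finset.single_le_sum (f := fun β => M.jointMoment θ t α β) (fun _ _ => zero_le)
    (Finset.mem_univ β)

/-- Exponentials turn the Chapman–Kolmogorov convolutions into products. Working in `[0, ∞]` avoids
any integrability assumption, so finiteness itself can be read off from this identity. -/
theorem jointMoment_add (θ : ℝ) (t s : ℝ≥0) (α γ : E) :
    M.jointMoment θ (t + s) α γ = ∑ β, M.jointMoment θ t α β * M.jointMoment θ s β γ := by
  simp only [jointMoment, transLaw_add, lintegral_finsetSum_measure, lintegral_exp_conv]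

theorem expMoment_add (θ : ℝ) (t s : ℝ≥0) (α : E) :
    M.expMoment θ (t + s) α = ∑ β, M.jointMoment θ t α β * M.expMoment θ s β := by
  simp only [← M.sum_jointMoment θ, M.jointMoment_add, Finset.mul_sum]
  rw [Finset.sum_comm]

theorem expMoment_ne_zero (θ : ℝ) (t : ℝ≥0) (α : E) : M.expMoment θ t α ≠ 0 := by
  have hm := M.measurable_ξ' t
  rw [expMoment, Ne, lintegral_eq_zero_iff (by fun_prop)]
  intro h
  obtain ⟨ω, hω⟩ := h.exists
  exact (ENNReal.ofReal_pos.2 (Real.exp_pos _)).ne' hω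

theorem jointMoment_ne_zero (θ : ℝ) {t : ℝ≥0} {α β : E}
    (h : (M.P (α, 0)) {ω | M.J t ω = β} ≠ 0) : M.jointMoment θ t α β ≠ 0 := by
  rw [jointMoment, Ne, lintegral_eq_zero_iff (by fun_prop)]
  intro h0
  have : NeZero (M.transLaw t α β) := by
    refine ⟨fun h1 => h ?_⟩
    rw [transLaw, Measure.map_eq_zero_iff (M.measurable_ξ' t).aemeasurable,
      Measure.restrict_eq_zero] at h1
    exact h1
  obtain ⟨ω, hω⟩ := h0.exists
  exact (ENNReal.ofReal_pos.2 (Real.exp_pos _)).ne' hω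

/-- In the decomposition of the moment at `t` through the state at `s`, each joint moment at `s` is
multiplied by a nonzero moment over the remaining time. An infinite one would make the whole sum
infinite. -/
theorem expMoment_ne_top_of_le (θ : ℝ) {s t : ℝ≥0} (hst : s ≤ t) {α : E}
    (h : M.expMoment θ t α ≠ ∞) : M.expMoment θ s α ≠ ∞ := by
  rw [← add_tsub_cancel_of_le hst, M.expMoment_add] at h
  rw [← M.sum_jointMoment]
  refine ENNReal.sum_ne_top.2 fun β hβ h1 => ENNReal.sum_ne_top.1 h β hβ ?_
  rw [h1]
  exact ENNReal.top_mul (M.expMoment_ne_zero _ _ _)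

/-- Exponential moments that are finite for small times are finite for all times. -/
theorem expMoment_ne_top_of_small (θ : ℝ) {δ : ℝ≥0} (hδ : 0 < δ)
    (h : ∀ α, M.expMoment θ δ α ≠ ∞) (t : ℝ≥0) (α : E) : M.expMoment θ t α ≠ ∞ := by
  have hn : ∀ n : ℕ, ∀ α, M.expMoment θ ((n + 1 : ℕ) • δ) α ≠ ∞ := by
    intro n
    induction n with
    | zero => simpa using h
    | succ n ih =>
      intro α
      rw [succ_nsmul, M.expMoment_add]
      exact ENNReal.sum_ne_top.2 fun β _ => ENNReal.mul_ne_top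
        (ne_top_of_le_ne_top (ih α) (M.jointMoment_le _ _ _ _)) (h β)
  obtain ⟨n, hn'⟩ := exists_nat_ge (t / δ)
  refine M.expMoment_ne_top_of_le θ ?_ (hn n α)
  rw [div_le_iff₀ hδ] at hn'
  rw [nsmul_eq_mul]
  refine hn'.trans ?_
  gcongr
  simp

/-- Exponential moments are bounded away from zero near time `0`. -/
theorem exists_half_le_expMoment (θ : ℝ) :
    ∃ δ : ℝ≥0, 0 < δ ∧ ∀ t ≤ δ, ∀ α, ENNReal.ofReal (1 / 2) ≤ M.expMoment θ t α := by
  classical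
  have hev : ∀ α, ∀ᶠ t in 𝓝 (0 : ℝ≥0), ENNReal.ofReal (1 / 2) ≤ M.expMoment θ t α := by
    intro α
    -- Only bounded test functions are allowed in the limit at time `0`, so the exponential is
    -- replaced by the smaller `min 1 (exp (θ y))`, which is `1` at `y = 0`.
    have hle : ∀ y : ℝ, ‖((min 1 (Real.exp (θ * y)) : ℝ) : ℂ)‖ = min 1 (Real.exp (θ * y)) :=
      fun y => by
        rw [Complex.norm_real, Real.norm_of_nonneg (le_min zero_le_one (Real.exp_nonneg _))]
    have h := (M.tendsto_integral_transLaw_zero α α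
      (g := fun y => ((min 1 (Real.exp (θ * y)) : ℝ) : ℂ)) (by fun_prop) (C := 1)
      (fun y => by rw [hle]; exact min_le_left _ _)).norm
    have h2 : (1 / 2 : ℝ) < ‖(if α = α then ((min 1 (Real.exp (θ * 0)) : ℝ) : ℂ) else 0)‖ := by
      norm_num
    filter_upwards [h.eventually_const_lt h2] with t ht
    refine le_trans ?_ (M.jointMoment_le θ t α α)
    refine le_trans (ENNReal.ofReal_le_ofReal ht.le) ?_
    rw [ofReal_norm]
    refine (enorm_integral_le_lintegral_enorm _).trans ?_
    refine lintegral_mono fun y => ?_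
    rw [← ofReal_norm, hle]
    exact ENNReal.ofReal_le_ofReal (min_le_right _ _)
  obtain ⟨ε, hε, h⟩ := Metric.eventually_nhds_iff.1 (eventually_all.2 hev)
  refine ⟨(ε / 2).toNNReal, by simpa using hε, fun t ht => h ?_⟩
  rw [NNReal.dist_eq, NNReal.coe_zero, sub_zero, NNReal.abs_eq]
  have : (t : ℝ) ≤ ε / 2 := by
    rw [← Real.coe_toNNReal (ε / 2) (by positivity)]; exact_mod_cast ht
  linarith

/-- Finite exponential moments are bounded near time `0`. -/
theorem exists_expMoment_le (θ : ℝ) (h : ∀ t α, M.expMoment θ t α ≠ ∞) :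
    ∃ δ : ℝ≥0, 0 < δ ∧ ∃ K : ℝ≥0, ∀ t ≤ δ, ∀ α, M.expMoment θ t α ≤ K := by
  obtain ⟨δ, hδ, hlow⟩ := M.exists_half_le_expMoment θ
  have hK : ∑ α, 2 * M.expMoment θ δ α ≠ ∞ :=
    ENNReal.sum_ne_top.2 fun α _ => ENNReal.mul_ne_top (by simp) (h δ α)
  refine ⟨δ, hδ, (∑ α, 2 * M.expMoment θ δ α).toNNReal, fun t ht α => ?_⟩
  rw [ENNReal.coe_toNNReal hK]
  refine le_trans ?_ (Finset.single_le_sum (f := fun α => 2 * M.expMoment θ δ α)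
    (fun _ _ => zero_le) (Finset.mem_univ α))
  -- The moment over the remaining time `δ - t` is at least `1/2` from every state, so the moment at
  -- `t` is at most twice the one at `δ`.
  have h1 := M.expMoment_add θ t (δ - t) α
  rw [add_tsub_cancel_of_le ht] at h1
  calc M.expMoment θ t α = 2 * ∑ β, M.jointMoment θ t α β * ENNReal.ofReal (1 / 2) := by
        rw [← Finset.sum_mul, M.sum_jointMoment, mul_comm, mul_assoc,
          show (2 : ℝ≥0∞) = ENNReal.ofReal 2 by simp, ← ENNReal.ofReal_mul (by norm_num)]
        norm_num
    _ ≤ 2 * M.expMoment θ δ α := by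
        rw [h1]
        gcongr with β
        exact hlow _ tsub_le_self β

theorem integrable_exp_transLaw (θ : ℝ) (h : ∀ t α, M.expMoment θ t α ≠ ∞) (t : ℝ≥0)
    (α β : E) : Integrable (fun y => Real.exp (θ * y)) (M.transLaw t α β) := by
  refine (lintegral_ofReal_ne_top_iff_integrable (by fun_prop)
    (.of_forall fun _ => Real.exp_nonneg _)).1 ?_
  exact ne_top_of_le_ne_top (h t α) (M.jointMoment_le θ t α β)

theorem integrable_cexp_transLaw {z : ℂ} {c θ : ℝ} (hz : z.re = c * θ) (h0 : 0 < c) (h1 : c < 1)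
    (h : ∀ t α, M.expMoment θ t α ≠ ∞) (t : ℝ≥0) (α β : E) :
    Integrable (fun y : ℝ => Complex.exp (z * y)) (M.transLaw t α β) :=
  ((integrable_const (1 : ℝ)).add (M.integrable_exp_transLaw θ h t α β)).mono'
    (by fun_prop) (.of_forall fun y => norm_cexp_le hz h0 h1 y)

/-- Continuity at time `0` of the exponential moments, at interior exponents. -/
theorem tendsto_integral_cexp_zero [DecidableEq E] {z : ℂ} {c θ : ℝ} (hz : z.re = c * θ)
    (h0 : 0 < c) (h1 : c < 1) (h : ∀ t α, M.expMoment θ t α ≠ ∞) (α β : E) :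
    Tendsto (fun t : ℝ≥0 => ∫ y : ℝ, Complex.exp (z * y) ∂(M.transLaw t α β)) (𝓝 0)
      (𝓝 (if α = β then 1 else 0)) := by
  obtain ⟨δ, hδ, K, hK⟩ := M.exists_expMoment_le θ h
  rw [Metric.tendsto_nhds]
  intro ε hε
  have hlim : Tendsto (fun R : ℝ => Real.exp (-((1 - c) * R)) * K) atTop (𝓝 0) := by
    have : Tendsto (fun R : ℝ => Real.exp (-((1 - c) * R))) atTop (𝓝 0) :=
      Real.tendsto_exp_neg_atTop_nhds_zero.comp
        (tendsto_id.const_mul_atTop (by linarith : 0 < 1 - c))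
    simpa using this.mul_const (K : ℝ)
  obtain ⟨R, hRε, hR0⟩ :=
    ((hlim.eventually_lt_const (half_pos hε)).and (eventually_ge_atTop 0)).exists
  -- The truncation agrees with the exponential where `θ y ≤ R` and is bounded by `exp (c R)`.
  -- Beyond `R` the error is at most `exp (c θ y)`, hence at most `exp (-(1 - c) R) exp (θ y)`. As
  -- `c < 1`, the bound `K` makes this small uniformly in small `t`.
  set g : ℝ → ℂ := fun y => Complex.exp (z * y) *
    ((min 1 (Real.exp (c * (R - θ * y))) : ℝ) : ℂ) with hg
  have hgc : Continuous g := by fun_prop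
  have hmin : ∀ y, 0 ≤ min 1 (Real.exp (c * (R - θ * y))) := fun y =>
    le_min zero_le_one (Real.exp_nonneg _)
  have hgb : ∀ y, ‖g y‖ ≤ Real.exp (c * R) := fun y => by
    rw [hg, norm_mul, norm_cexp_mul_ofReal hz, Complex.norm_real, Real.norm_of_nonneg (hmin y)]
    calc _ ≤ Real.exp (c * (θ * y)) * Real.exp (c * (R - θ * y)) := by
          gcongr; exact min_le_right _ _
      _ = _ := by rw [← Real.exp_add]; ring_nf
  have hg0 : g 0 = 1 := by
    have : 1 ≤ Real.exp (c * R) := Real.one_le_exp (by positivity)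
    simp [hg, this]
  have hdiff : ∀ y : ℝ, ‖Complex.exp (z * y) - g y‖
      ≤ Real.exp (-((1 - c) * R)) * Real.exp (θ * y) := fun y => by
    have : Complex.exp (z * y) - g y = Complex.exp (z * y) *
        ((1 - min 1 (Real.exp (c * (R - θ * y))) : ℝ) : ℂ) := by
      simp only [hg]; push_cast; ring
    rw [this, norm_mul, norm_cexp_mul_ofReal hz, Complex.norm_real,
      Real.norm_of_nonneg (sub_nonneg.2 (min_le_left _ _))]
    rcases le_total (θ * y) R with hy | hy
    · rw [min_eq_left (Real.one_le_exp (mul_nonneg h0.le (by linarith)))]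
      simp; positivity
    · calc _ ≤ Real.exp (c * (θ * y)) * 1 := by gcongr; linarith [hmin y]
        _ ≤ _ := by
          rw [mul_one, ← Real.exp_add, Real.exp_le_exp]
          nlinarith
  have hgt := M.tendsto_integral_transLaw_zero α β hgc hgb
  rw [hg0, Metric.tendsto_nhds] at hgt
  filter_upwards [hgt (ε / 2) (half_pos hε), Iic_mem_nhds hδ] with t ht htδ
  have hgi : Integrable g (M.transLaw t α β) :=
    Integrable.of_bound hgc.aestronglyMeasurable _ (.of_forall hgb)
  have hKr : ∫ y, Real.exp (θ * y) ∂(M.transLaw t α β) ≤ K := by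
    rw [integral_eq_lintegral_of_nonneg_ae (.of_forall fun _ => Real.exp_nonneg _) (by fun_prop)]
    exact ENNReal.toReal_le_of_le_ofReal K.2 (by
      rw [ENNReal.ofReal_coe_nnreal]
      exact (M.jointMoment_le θ t α β).trans (hK t htδ α))
  have hd : dist (∫ y : ℝ, Complex.exp (z * y) ∂(M.transLaw t α β))
      (∫ y, g y ∂(M.transLaw t α β)) ≤ Real.exp (-((1 - c) * R)) * K := by
    rw [dist_eq_norm, ← integral_sub (M.integrable_cexp_transLaw hz h0 h1 h t α β) hgi]
    calc _ ≤ ∫ y, Real.exp (-((1 - c) * R)) * Real.exp (θ * y) ∂(M.transLaw t α β) :=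
          norm_integral_le_of_norm_le ((M.integrable_exp_transLaw θ h t α β).const_mul _)
            (.of_forall hdiff)
      _ ≤ _ := by rw [integral_const_mul]; gcongr
  linarith [dist_triangle (∫ y : ℝ, Complex.exp (z * y) ∂(M.transLaw t α β))
    (∫ y, g y ∂(M.transLaw t α β)) (if α = β then 1 else 0)]

theorem ofReal_Y_cpow (t : ℝ≥0) (ω : Ω) (z : ℂ) :
    (M.Y t ω : ℂ) ^ z = Complex.exp (z * (M.ξ t ω : ℂ)) := by
  rw [Y, Complex.cpow_def_of_ne_zero (by exact_mod_cast (Real.exp_pos _).ne'),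
    ← Complex.ofReal_log (Real.exp_pos _).le, Real.log_exp, mul_comm]

/-! ### Existence of the matrix exponent and irreducibility at small times. -/

section Exponent

attribute [local instance] Matrix.linftyOpNormedRing Matrix.linftyOpNormedAlgebra

/-- The matrix exponent exists strictly between `0` and a real exponent with finite moments. -/
theorem exists_isMatrixExponent [DecidableEq E] {z : ℂ} {c θ : ℝ} (hz : z.re = c * θ)
    (h0 : 0 < c) (h1 : c < 1) (h : ∀ t α, M.expMoment θ t α ≠ ∞) :
    ∃ A, M.IsMatrixExponent z A := by
  set S : ℝ≥0 → Matrix E E ℂ := fun t => Matrix.of fun α β =>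
    ∫ y : ℝ, Complex.exp (z * y) ∂(M.transLaw t α β) with hS
  have hint := M.integrable_cexp_transLaw hz h0 h1 h
  have hS0 : S 0 = 1 := by
    ext α β
    simp only [hS, Matrix.of_apply, M.transLaw_zero, Matrix.one_apply]
    split_ifs <;> simp
  have hSadd : ∀ s t, S (s + t) = S s * S t := by
    intro s t
    ext α γ
    simp only [hS, Matrix.of_apply, Matrix.mul_apply, M.transLaw_add]
    rw [integral_finsetSum_measure fun β _ => integrable_cexp_conv (hint s α β) (hint t β γ)]
    simp only [integral_cexp_conv]
  -- The norm on matrices induces the product topology, so entrywise limits suffice.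
  have hSc : ContinuousAt S 0 := by
    rw [ContinuousAt, hS0]
    refine tendsto_pi_nhds.2 fun α => tendsto_pi_nhds.2 fun β => ?_
    rw [Matrix.one_apply]
    exact M.tendsto_integral_cexp_zero hz h0 h1 h α β
  obtain ⟨A, hA⟩ := exists_eq_exp_of_semigroup hS0 hSadd hSc
  refine ⟨A, fun t α β => ⟨?_, ?_⟩⟩
  · rw [← M.sum_restrict_J (M.P (α, 0)) t]
    refine integrable_finsetSum_measure.2 fun β _ => ?_
    exact (hint t α β).comp_measurable (M.measurable_ξ' t)
  · rw [← M.integral_transLaw t α β (g := fun y : ℝ => Complex.exp (z * y)) (by fun_prop)]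
    exact congrFun (congrFun (hA t) α) β

theorem isMatrixExponent_matrixExponent [DecidableEq E] {z : ℂ}
    (h : ∃ A, M.IsMatrixExponent z A) : M.IsMatrixExponent z (M.matrixExponent z) := by
  rw [matrixExponent, dif_pos h]
  exact h.choose_spec

/-- Irreducibility gives positive transition probabilities at arbitrarily small times. -/
theorem Irreducible.exists_lt_of_pos (hJ : M.Irreducible) (α β : E) {T : ℝ≥0} (hT : 0 < T) :
    ∃ t < T, (M.P (α, 0)) {ω | M.J t ω = β} ≠ 0 := by
  classical
  -- `Q` is the generator of `J`: the exponent at `z = 0` exists because all moments of order `θ =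
  -- 0` equal `1`.
  obtain ⟨Q, hQ⟩ := M.exists_isMatrixExponent (z := 0) (c := 1 / 2) (θ := 0) (by simp)
    (by norm_num) (by norm_num) (fun t α => by simp [expMoment])
  have hp : ∀ t : ℝ≥0, NormedSpace.exp (((t : ℝ) : ℂ) • Q) α β
      = (((M.P (α, 0)) {ω | M.J t ω = β}).toReal : ℂ) := fun t => by
    rw [← (hQ t α β).2]
    simp [measureReal_def]
  by_contra! hcon
  -- The transition probability extends to an entire function of time. If it vanished on `(0, T)` it
  -- would vanish identically, contradicting irreducibility.
  set f : ℂ → ℂ := fun w => NormedSpace.exp (w • Q) α β with hf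
  have hfd : Differentiable ℂ f := fun w => by
    have h1 : DifferentiableAt ℂ (fun w : ℂ => NormedSpace.exp (w • Q)) w :=
      differentiableAt_exp_smul_const Q w
    let e : Matrix E E ℂ →ₗ[ℂ] ℂ := Matrix.entryLinearMap ℂ ℂ α β
    exact (LinearMap.toContinuousLinearMap e).differentiableAt.comp w h1
  have hfreq : ∃ᶠ w in 𝓝[≠] (0 : ℂ), f w = 0 := by
    have ht : Tendsto (fun x : ℝ => (x : ℂ)) (𝓝[>] 0) (𝓝[≠] 0) := by
      refine tendsto_nhdsWithin_iff.2 ⟨?_, ?_⟩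
      · exact (Complex.continuous_ofReal.tendsto' 0 0 (by simp)).mono_left nhdsWithin_le_nhds
      · filter_upwards [self_mem_nhdsWithin] with x hx
        simpa using (ne_of_gt hx)
    refine ht.frequently (Eventually.frequently ?_)
    filter_upwards [Ioo_mem_nhdsGT (show (0 : ℝ) < T from hT)] with x hx
    have h2 := hp ⟨x, hx.1.le⟩
    rw [hcon ⟨x, hx.1.le⟩ hx.2] at h2
    rw [ENNReal.toReal_zero, Complex.ofReal_zero] at h2
    exact h2
  have hzero := AnalyticOnNhd.eqOn_zero_of_preconnected_of_frequently_eq_zero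
    (fun w _ => hfd.analyticAt w) isPreconnected_univ (Set.mem_univ 0) hfreq
  obtain ⟨t, ht⟩ := hJ α β
  have h3 := (hp t).symm.trans (hzero (Set.mem_univ _))
  simp only [Pi.zero_apply, Complex.ofReal_eq_zero] at h3
  exact (ENNReal.toReal_pos ht.ne' (measure_ne_top _ _)).ne' h3

end Exponent

/-! ### Propagation of finite moments from one initial law to all states. -/

/-- Under irreducibility, finiteness of one exponential moment at one positive time and one
initial state implies finiteness at all times and all initial states. -/
theorem Irreducible.expMoment_ne_top (hJ : M.Irreducible) (θ : ℝ) {T : ℝ≥0} (hT : 0 < T) {α₀ : E}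
    (h : M.expMoment θ T α₀ ≠ ∞) (t : ℝ≥0) (α : E) : M.expMoment θ t α ≠ ∞ := by
  -- From `α₀` the state `β` is reached with positive probability at some `t < T`, which leaves the
  -- positive time `T - t` for the process from `β`.
  have hr : ∀ β, ∃ r : ℝ≥0, 0 < r ∧ M.expMoment θ r β ≠ ∞ := by
    intro β
    obtain ⟨t, htT, ht⟩ := Irreducible.exists_lt_of_pos M hJ α₀ β hT
    refine ⟨T - t, tsub_pos_of_lt htT, fun htop => ?_⟩
    rw [← add_tsub_cancel_of_le htT.le, M.expMoment_add] at h
    refine ENNReal.sum_ne_top.1 h β (Finset.mem_univ β) ?_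
    rw [htop]
    exact ENNReal.mul_top (M.jointMoment_ne_zero θ ht)
  choose r hr0 hrfin using hr
  have : Nonempty E := ⟨α₀⟩
  obtain ⟨β₀, hβ₀⟩ := Finite.exists_min r
  exact M.expMoment_ne_top_of_small θ (hr0 β₀)
    (fun α => M.expMoment_ne_top_of_le θ (hβ₀ α) (hrfin α)) t α

/-- A finite exponential moment under some initial law is finite for some initial state. -/
theorem exists_expMoment_ne_top (ν : Measure (E × ℝ)) [IsProbabilityMeasure ν] (θ : ℝ) (T : ℝ≥0)
    (h : Integrable (fun ω => M.Y T ω ^ θ) (M.lawFrom ν)) : ∃ α, M.expMoment θ T α ≠ ∞ := by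
  have hm := M.measurable_ξ' T
  have hY : ∀ ω, M.Y T ω ^ θ = Real.exp (θ * M.ξ T ω) := fun ω => by
    rw [Y, ← Real.exp_mul, mul_comm]
  simp only [hY] at h
  have h1 := (lintegral_ofReal_ne_top_iff_integrable h.1
    (.of_forall fun _ => Real.exp_nonneg _)).2 h
  rw [lawFrom, Measure.lintegral_bind M.P.aemeasurable (by fun_prop)] at h1
  obtain ⟨⟨α, x⟩, hx⟩ := (ae_lt_top' (Measurable.lintegral_kernel
    (by fun_prop)).aemeasurable h1).exists
  refine ⟨α, fun htop => hx.ne ?_⟩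
  rw [← lintegral_map (f := fun y => ENNReal.ofReal (Real.exp (θ * y))) (by fun_prop) hm,
    M.map_ξ_start, lintegral_map (by fun_prop) (by fun_prop), lintegral_map (by fun_prop) hm]
  simp only [mul_add, Real.exp_add, ENNReal.ofReal_mul (Real.exp_nonneg _)]
  rw [lintegral_const_mul _ (by fun_prop)]
  rw [expMoment] at htop
  rw [htop]
  exact ENNReal.mul_top (ENNReal.ofReal_pos.2 (Real.exp_pos _)).ne'

end MarkovAdditiveProcess

/-! ### Mellin transforms of payoffs and of their expectations. -/

/-- The Mellin transform of the call payoff, as a function of the strike. -/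
theorem hasMellin_call {y : ℝ} (hy : 0 < y) {u : ℂ} (hu : 0 < u.re) :
    HasMellin (fun k : ℝ => ((max (y - k) 0 : ℝ) : ℂ)) u ((y : ℂ) ^ (u + 1) / (u * (u + 1))) := by
  have hu0 : u ≠ 0 := fun h => by simp [h] at hu
  have hu1 : u + 1 ≠ 0 := fun h => by
    have := congrArg Complex.re h
    simp at this; linarith
  have hy0 : (y : ℂ) ≠ 0 := by exact_mod_cast hy.ne'
  have e1 : -1 < (u - 1).re := by simpa using hu
  have e2 : -1 < u.re := by linarith
  have hind : ∀ k ∈ Set.Ioi (0 : ℝ), (k : ℂ) ^ (u - 1) • ((max (y - k) 0 : ℝ) : ℂ)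
      = (Set.Ioc 0 y).indicator (fun k : ℝ => y * (k : ℂ) ^ (u - 1) - (k : ℂ) ^ u) k := by
    intro k hk
    have hk0 : (k : ℂ) ≠ 0 := by exact_mod_cast (ne_of_gt hk)
    rcases le_or_gt k y with h | h
    · rw [Set.indicator_of_mem (Set.mem_Ioc.2 ⟨hk, h⟩), max_eq_left (by linarith), smul_eq_mul,
        Complex.cpow_sub _ _ hk0, Complex.cpow_one]
      push_cast
      field_simp
    · rw [Set.indicator_of_notMem (fun h' => absurd h'.2 (not_le.2 h)), max_eq_right (by linarith)]
      simp
  have i1 : IntervalIntegrable (fun k : ℝ => y * (k : ℂ) ^ (u - 1)) volume 0 y :=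
    (intervalIntegral.intervalIntegrable_cpow' e1).const_mul _
  have i2 : IntervalIntegrable (fun k : ℝ => (k : ℂ) ^ u) volume 0 y :=
    intervalIntegral.intervalIntegrable_cpow' e2
  constructor
  · refine IntegrableOn.congr_fun ?_ (fun k hk => (hind k hk).symm) measurableSet_Ioi
    have := (intervalIntegrable_iff_integrableOn_Ioc_of_le hy.le).1 (i1.sub i2)
    exact (this.integrable_indicator measurableSet_Ioc).integrableOn
  · rw [mellin, setIntegral_congr_fun measurableSet_Ioi hind,
      setIntegral_indicator measurableSet_Ioc,
      Set.inter_eq_self_of_subset_right Set.Ioc_subset_Ioi_self,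
      ← intervalIntegral.integral_of_le hy.le, intervalIntegral.integral_sub i1 i2,
      intervalIntegral.integral_const_mul, integral_cpow (Or.inl e1), integral_cpow (Or.inl e2),
      sub_add_cancel, Complex.ofReal_zero, Complex.zero_cpow hu0, Complex.zero_cpow hu1,
      Complex.cpow_add _ _ hy0, Complex.cpow_one]
    field_simp
    ring

/-- The Mellin transform of the put payoff, as a function of the strike. -/
theorem hasMellin_put {y : ℝ} (hy : 0 < y) {u : ℂ} (hu : u.re < -1) :
    HasMellin (fun k : ℝ => ((max (k - y) 0 : ℝ) : ℂ)) u ((y : ℂ) ^ (u + 1) / (u * (u + 1))) := by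
  have hu0 : u ≠ 0 := fun h => by simp [h] at hu; linarith
  have hu1 : u + 1 ≠ 0 := fun h => by
    have := congrArg Complex.re h
    simp at this; linarith
  have hy0 : (y : ℂ) ≠ 0 := by exact_mod_cast hy.ne'
  have e1 : (u - 1).re < -1 := by simp; linarith
  have hind : ∀ k ∈ Set.Ioi (0 : ℝ), (k : ℂ) ^ (u - 1) • ((max (k - y) 0 : ℝ) : ℂ)
      = (Set.Ioi y).indicator (fun k : ℝ => (k : ℂ) ^ u - y * (k : ℂ) ^ (u - 1)) k := by
    intro k hk
    have hk0 : (k : ℂ) ≠ 0 := by exact_mod_cast (ne_of_gt hk)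
    rcases lt_or_ge y k with h | h
    · rw [Set.indicator_of_mem (Set.mem_Ioi.2 h), max_eq_left (by linarith), smul_eq_mul,
        Complex.cpow_sub _ _ hk0, Complex.cpow_one]
      push_cast
      field_simp
    · rw [Set.indicator_of_notMem (by simpa using h), max_eq_right (by linarith)]
      simp
  have i1 : IntegrableOn (fun k : ℝ => y * (k : ℂ) ^ (u - 1)) (Set.Ioi y) :=
    (integrableOn_Ioi_cpow_of_lt e1 hy).const_mul _
  have i2 : IntegrableOn (fun k : ℝ => (k : ℂ) ^ u) (Set.Ioi y) :=
    integrableOn_Ioi_cpow_of_lt hu hy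
  constructor
  · refine IntegrableOn.congr_fun ?_ (fun k hk => (hind k hk).symm) measurableSet_Ioi
    exact (IntegrableOn.integrable_indicator (i2.sub i1) measurableSet_Ioi).integrableOn
  · rw [mellin, setIntegral_congr_fun measurableSet_Ioi hind,
      setIntegral_indicator measurableSet_Ioi,
      Set.inter_eq_self_of_subset_right (Set.Ioi_subset_Ioi hy.le), integral_sub i2 i1,
      integral_const_mul, integral_Ioi_cpow_of_lt e1 hy, integral_Ioi_cpow_of_lt hu hy,
      sub_add_cancel, Complex.cpow_add _ _ hy0, Complex.cpow_one]
    field_simp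
    ring

/-- The Mellin transform in the strike of an expected payoff whose Mellin transform at each
price `y` is `y ^ (u + 1) / (u (u + 1))`. -/
theorem hasMellin_integral {Ω : Type*} [MeasurableSpace Ω] (μ : Measure Ω) [SFinite μ]
    {X : Ω → ℝ} (hX : Measurable X) (hX0 : ∀ ω, 0 < X ω) {H : ℝ → ℝ → ℝ}
    (hH : Measurable (Function.uncurry H)) (hH0 : ∀ y k, 0 ≤ H y k) {u : ℂ}
    (hmel : ∀ y, 0 < y → ∀ w : ℂ, w.re = u.re →
      HasMellin (fun k : ℝ => (H y k : ℂ)) w ((y : ℂ) ^ (w + 1) / (w * (w + 1))))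
    (hint : Integrable (fun ω => X ω ^ (u.re + 1)) μ) :
    HasMellin (fun k : ℝ => ((∫ ω, H (X ω) k ∂μ : ℝ) : ℂ)) u
      ((∫ ω, (X ω : ℂ) ^ (u + 1) ∂μ) / (u * (u + 1))) := by
  set F : Ω × ℝ → ℂ := fun p => (p.2 : ℂ) ^ (u - 1) • (H (X p.1) p.2 : ℂ) with hF
  have hFm : Measurable F := by
    have h1 : Measurable fun p : Ω × ℝ => (p.2 : ℂ) ^ (u - 1) :=
      (Complex.measurable_ofReal.comp measurable_snd).pow_const _
    have h2 : Measurable fun p : Ω × ℝ => (H (X p.1) p.2 : ℂ) :=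
      Complex.measurable_ofReal.comp (hH.comp ((hX.comp measurable_fst).prodMk measurable_snd))
    exact h1.smul h2
  -- On `k > 0` the norm of the integrand is `k ^ (Re u - 1)` times the payoff, so the Mellin
  -- formula at the real point `Re u` computes its integral. This is why `hmel` covers every `w` on
  -- the vertical line through `u`.
  have hnorm : ∀ ω, ∫ k in Set.Ioi (0 : ℝ), ‖F (ω, k)‖
      = X ω ^ (u.re + 1) / (u.re * (u.re + 1)) := by
    intro ω
    have h := (hmel (X ω) (hX0 ω) (u.re : ℂ) (by simp)).2
    have h1 : ∀ k ∈ Set.Ioi (0 : ℝ), (k : ℂ) ^ ((u.re : ℂ) - 1) • (H (X ω) k : ℂ)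
        = ((‖F (ω, k)‖ : ℝ) : ℂ) := by
      intro k hk
      simp only [hF]
      rw [norm_smul, Complex.norm_cpow_eq_rpow_re_of_pos hk, Complex.norm_real,
        Real.norm_of_nonneg (hH0 _ _), Complex.ofReal_mul, Complex.ofReal_cpow (le_of_lt hk)]
      simp
    rw [mellin, setIntegral_congr_fun measurableSet_Ioi h1, integral_complex_ofReal] at h
    have h2 : (X ω : ℂ) ^ ((u.re : ℂ) + 1) = ((X ω ^ (u.re + 1) : ℝ) : ℂ) := by
      rw [Complex.ofReal_cpow (hX0 ω).le]; simp
    rw [h2] at h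
    exact_mod_cast h
  have hFi : Integrable F (μ.prod (volume.restrict (Set.Ioi 0))) := by
    rw [integrable_prod_iff hFm.aestronglyMeasurable]
    refine ⟨.of_forall fun ω => (hmel (X ω) (hX0 ω) u rfl).1, ?_⟩
    simp only [hnorm]
    exact hint.div_const _
  have hswap : ∀ k : ℝ, (k : ℂ) ^ (u - 1) • ((∫ ω, H (X ω) k ∂μ : ℝ) : ℂ)
      = ∫ ω, F (ω, k) ∂μ := fun k => by
    simp only [hF]
    rw [integral_smul, integral_complex_ofReal]
  constructor
  · rw [MellinConvergent, IntegrableOn]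
    simp only [hswap]
    exact hFi.integral_prod_right
  · rw [mellin]
    simp only [hswap]
    rw [← integral_integral_swap (f := fun ω k => F (ω, k)) hFi, ← integral_div]
    exact integral_congr_ae (.of_forall fun ω => (hmel (X ω) (hX0 ω) u rfl).2)

/-! ### The pricing formulas. -/

namespace MarkovAdditiveProcess

variable {E Ω : Type*} [Fintype E] [DecidableEq E] [TopologicalSpace E] [DiscreteTopology E]
  [MeasurableSpace E] [MeasurableSingletonClass E] [MeasurableSpace Ω]
  (M : MarkovAdditiveProcess E Ω)

/-- The total mass of a row of `exp (t F(z))` is the exponential moment of `ξ t`. -/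
theorem IsMatrixExponent.sum_exp {M : MarkovAdditiveProcess E Ω} {z : ℂ} {A : Matrix E E ℂ}
    (hA : M.IsMatrixExponent z A) (t : ℝ≥0) (α : E) :
    ∑ β, NormedSpace.exp (((t : ℝ) : ℂ) • A) α β
      = ∫ ω, Complex.exp (z * (M.ξ t ω : ℂ)) ∂(M.P (α, 0)) := by
  simp only [← (hA t α _).2]
  rw [← integral_finsetSum_measure fun β _ => (hA t α β).1.integrableOn, M.sum_restrict_J]

/-- The Mellin transform in the strike of the price of a European option. -/
theorem IsMatrixExponent.hasMellin_europeanPrice {M : MarkovAdditiveProcess E Ω} {u : ℂ}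
    {A : Matrix E E ℂ} (hA : M.IsMatrixExponent (u + 1) A) (r : ℝ) (T : ℝ≥0) (α : E)
    {H : ℝ → ℝ → ℝ} (hH : Measurable (Function.uncurry H)) (hH0 : ∀ y k, 0 ≤ H y k)
    (hmel : ∀ y, 0 < y → ∀ w : ℂ, w.re = u.re →
      HasMellin (fun k : ℝ => (H y k : ℂ)) w ((y : ℂ) ^ (w + 1) / (w * (w + 1)))) :
    HasMellin (fun k : ℝ => (M.europeanPrice r (fun y => H y k) α 1 T : ℂ)) u
      ((Real.exp (-r * T) : ℂ) / (u * (u + 1)) *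
        ∑ β, NormedSpace.exp (((T : ℝ) : ℂ) • A) α β) := by
  have hint : Integrable (fun ω => M.Y T ω ^ (u.re + 1)) (M.P (α, 0)) := by
    refine (hA T α α).1.norm.congr (.of_forall fun ω => ?_)
    simp only [Y]
    rw [← Real.exp_mul, Complex.norm_exp]
    simp [mul_comm]
  have h := hasMellin_integral (M.P (α, 0)) (X := M.Y T) (M.measurable_ξ' T).exp
    (fun ω => Real.exp_pos _) hH hH0 hmel hint
  simp only [europeanPrice, Real.log_one, Complex.ofReal_mul]
  refine ⟨h.1.const_smul (Real.exp (-r * T) : ℂ), ?_⟩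
  have h2 := mellin_const_smul (fun k : ℝ => ((∫ ω, H (M.Y T ω) k ∂(M.P (α, 0)) : ℝ) : ℂ)) u
    (Real.exp (-r * T) : ℂ)
  simp only [smul_eq_mul] at h2
  rw [h2, h.2, hA.sum_exp]
  simp only [ofReal_Y_cpow]
  ring

/-- Existence of the matrix exponent strictly between `0` and an exponent with a finite moment
under some initial law. -/
theorem Irreducible.isMatrixExponent (hJ : M.Irreducible) (ν : Measure (E × ℝ))
    [IsProbabilityMeasure ν] {T : ℝ≥0} (hT : 0 < T) {θ c : ℝ}
    (h : Integrable (fun ω => M.Y T ω ^ θ) (M.lawFrom ν)) {z : ℂ} (hz : z.re = c * θ)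
    (h0 : 0 < c) (h1 : c < 1) : M.IsMatrixExponent z (M.matrixExponent z) := by
  obtain ⟨α₀, hα₀⟩ := M.exists_expMoment_ne_top ν θ T h
  exact M.isMatrixExponent_matrixExponent
    (M.exists_isMatrixExponent hz h0 h1 (Irreducible.expMoment_ne_top M hJ θ hT hα₀))

end MarkovAdditiveProcess

theorem mainTheorem2 {E Ω : Type*} [Fintype E] [DecidableEq E] [TopologicalSpace E]
    [DiscreteTopology E] [MeasurableSpace E] [MeasurableSingletonClass E] [MeasurableSpace Ω]
    (M : MarkovAdditiveProcess E Ω) (hJ : M.Irreducible)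
    (ν : Measure (E × ℝ)) [IsProbabilityMeasure ν]
    (r : ℝ) (T : ℝ≥0) (hT : 0 < T) (s : ℝ) (hs : 0 < s) :
    (Integrable (fun ω => M.Y T ω ^ (1 + s)) (M.lawFrom ν) →
      ∀ (α : E) (u : ℂ), 0 < u.re → u.re < s →
        M.IsMatrixExponent (u + 1) (M.matrixExponent (u + 1)) ∧
        HasMellin (fun k : ℝ => (M.callPrice r T α k : ℂ)) u
          ((Real.exp (-r * T) : ℂ) / (u * (u + 1)) *
            ∑ β : E, NormedSpace.exp (((T : ℝ) : ℂ) • M.matrixExponent (u + 1)) α β)) ∧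
    (Integrable (fun ω => M.Y T ω ^ (-s)) (M.lawFrom ν) →
      ∀ (α : E) (u : ℂ), -s < u.re → u.re < -1 →
        M.IsMatrixExponent (u + 1) (M.matrixExponent (u + 1)) ∧
        HasMellin (fun k : ℝ => (M.putPrice r T α k : ℂ)) u
          ((Real.exp (-r * T) : ℂ) / (u * (u + 1)) *
            ∑ β : E, NormedSpace.exp (((T : ℝ) : ℂ) • M.matrixExponent (u + 1)) α β)) := by
  refine ⟨fun h α u hu0 hus => ?_, fun h α u hsu hu1 => ?_⟩
  -- Here `θ = 1 + s`, and `Re u + 1` lies strictly between `0` and `θ`.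
  · have hA : M.IsMatrixExponent (u + 1) (M.matrixExponent (u + 1)) :=
      MarkovAdditiveProcess.Irreducible.isMatrixExponent M hJ ν hT h (c := (u.re + 1) / (1 + s))
        (by simp; field_simp) (by positivity) (by rw [div_lt_one (by linarith)]; linarith)
    exact ⟨hA, hA.hasMellin_europeanPrice r T α (H := fun y k => max (y - k) 0)
      (by unfold Function.uncurry; fun_prop) (fun _ _ => le_max_right _ _)
      fun y hy w hw => hasMellin_call hy (by linarith)⟩
  -- Here `θ = -s`, and `Re u + 1` is negative and greater than `1 - s`, so `c` lies in `(0, 1)`.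
  · have hA : M.IsMatrixExponent (u + 1) (M.matrixExponent (u + 1)) :=
      MarkovAdditiveProcess.Irreducible.isMatrixExponent M hJ ν hT h (c := -(u.re + 1) / s)
        (by simp; field_simp; ring) (div_pos (by linarith) hs) (by rw [div_lt_one hs]; linarith)
    exact ⟨hA, hA.hasMellin_europeanPrice r T α (H := fun y k => max (k - y) 0)
      (by unfold Function.uncurry; fun_prop) (fun _ _ => le_max_right _ _)
      fun y hy w hw => hasMellin_put hy (by linarith)⟩
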